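/- Let $E=\{z\in\mathbb{C}:|z|<1\}$, and let $f(z)=z+a_2z^2+a_3z^3+\cdots$ be analytic in $E$ and of bounded turning, that is, $\operatorname{Re} f'(z)>0$ for all $z\in E$. Let $$H_3(1)=\begin{vmatrix} a_1&a_2&a_3\\ a_2&a_3&a_4\\ a_3&a_4&a_5\end{vmatrix},\qquad a_1=1,$$ be its third Hankel determinant. Then $$|H_3(1)|\le\frac{993}{1620}.$$ -/

import Mathlib

/-- The open unit disk `E = {z : |z| < 1}`. -/
def unitDiskE : Set ℂ := {z : ℂ | ‖z‖ < 1}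

/-- The class `A` of functions `f(z) = z + a₂ z² + ⋯` analytic in `E`. -/
structure ClassA (f : ℂ → ℂ) : Prop where
  analytic : AnalyticOnNhd ℂ f unitDiskE
  map_zero : f 0 = 0
  deriv_zero : deriv f 0 = 1

/-- The class `R` of functions of bounded turning: `f ∈ A` and `Re f'(z) > 0` for `z ∈ E`. -/
structure BoundedTurning (f : ℂ → ℂ) : Prop extends ClassA f where
  re_deriv_pos : ∀ z ∈ unitDiskE, 0 < (deriv f z).re

/-- The `n`-th Taylor coefficient `aₙ` of `f` at the origin. -/
noncomputable def taylorCoeff (f : ℂ → ℂ) (n : ℕ) : ℂ :=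
  iteratedDeriv n f 0 / (n.factorial : ℂ)

/-- The `q`-th Hankel determinant `H_q(n)` of `f`, the determinant of the `q × q` matrix whose
`(i, j)` entry (counted from `0`) is `a_{n+i+j}`. -/
noncomputable def hankelDet (f : ℂ → ℂ) (q n : ℕ) : ℂ :=
  Matrix.det (Matrix.of fun i j : Fin q => taylorCoeff f (n + (i : ℕ) + (j : ℕ)))

/-! ### Moments of a probability measure on the circle, and the resulting extremal problem. -/

section
open MeasureTheory ComplexConjugate

/-! Write `p = f' = 1 + c₁z + c₂z² + ⋯`. On each circle of radius `r < 1`, `Re p` is, up to a factor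
`2π`, a probability density whose `k`-th moment is `c_k r^k / 2`
(`exists_probabilityMeasure_moments`). Since `H₃(1)` is isobaric of weight 6 in the `c_k`, `r ^ 6 *
H₃(1)` is a polynomial in the first four moments.

Orthogonal polynomials parametrize the first three moments by points `g, x, y` of the closed disk
(`exists_schur_parameters`); of the fourth, only modulus at most 1 is used. The triangle inequality
then leaves a real polynomial in `‖g‖` and `‖x‖`, bounded by `331/540 = 993/1620` in `majorant_le`.
Letting `r → 1` finishes the proof. -/

theorem integral_trigonometric_polynomial {α : Type*} [MeasurableSpace α] (μ : Measure α)
    [IsProbabilityMeasure μ] (u : α → ℂ) (hu : Measurable u) (hu1 : ∀ t, ‖u t‖ = 1)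
    (c₀ c₁ c₂ c₃ d₁ d₂ : ℂ) :
    ∫ t, (c₀ + c₁ * u t + c₂ * u t ^ 2 + c₃ * u t ^ 3 + d₁ * conj (u t) + d₂ * conj (u t ^ 2)) ∂μ
      = c₀ + c₁ * ∫ t, u t ∂μ + c₂ * ∫ t, u t ^ 2 ∂μ + c₃ * ∫ t, u t ^ 3 ∂μ
        + d₁ * conj (∫ t, u t ∂μ) + d₂ * conj (∫ t, u t ^ 2 ∂μ) := by
  have hi : ∀ k : ℕ, Integrable (fun t => u t ^ k) μ := fun k =>
    Integrable.of_bound (hu.pow_const k).aestronglyMeasurable 1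
      (Filter.Eventually.of_forall fun t => by simp [hu1])
  have h1 : Integrable u μ := by simpa using hi 1
  have hc : ∀ k : ℕ, Integrable (fun t => conj (u t ^ k)) μ := fun k =>
    Integrable.of_bound
      ((Complex.continuous_conj.measurable.comp (hu.pow_const k)).aestronglyMeasurable) 1
      (Filter.Eventually.of_forall fun t => by simp [hu1])
  have hc1 : Integrable (fun t => conj (u t)) μ := by simpa using hc 1
  have e0 : Integrable (fun _ : α => c₀) μ := integrable_const _
  have e1 := h1.const_mul c₁
  have e2 := (hi 2).const_mul c₂
  have e3 := (hi 3).const_mul c₃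
  have e4 := hc1.const_mul d₁
  have e5 := (hc 2).const_mul d₂
  have s1 : Integrable (fun t => c₀ + c₁ * u t) μ := e0.add e1
  have s2 : Integrable (fun t => c₀ + c₁ * u t + c₂ * u t ^ 2) μ := s1.add e2
  have s3 : Integrable (fun t => c₀ + c₁ * u t + c₂ * u t ^ 2 + c₃ * u t ^ 3) μ := s2.add e3
  have s4 : Integrable (fun t => c₀ + c₁ * u t + c₂ * u t ^ 2 + c₃ * u t ^ 3
    + d₁ * conj (u t)) μ := s3.add e4
  rw [integral_add s4 e5, integral_add s3 e4, integral_add s2 e3, integral_add s1 e2,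
    integral_add e0 e1]
  simp only [integral_const_mul, integral_conj]
  simp

/-- Since `|u| = 1`, both integrands have modulus `|φ|²`. With `φ` a monic orthogonal polynomial in
`u`, this confines the next moment to a disk. -/
theorem norm_integral_conj_mul_sq_le {α : Type*} [MeasurableSpace α] (μ : Measure α)
    (u φ : α → ℂ) (hu1 : ∀ t, ‖u t‖ = 1) :
    ‖∫ t, conj (u t) * φ t ^ 2 ∂μ‖ ≤ (∫ t, φ t * conj (φ t) ∂μ).re := by
  have h2 : ∫ t, φ t * conj (φ t) ∂μ = ((∫ t, ‖φ t‖ ^ 2 ∂μ : ℝ) : ℂ) := by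
    rw [← integral_complex_ofReal]
    congr 1
    ext t
    rw [Complex.mul_conj']
    push_cast
    rfl
  rw [h2, Complex.ofReal_re]
  refine (norm_integral_le_integral_norm _).trans (le_of_eq ?_)
  congr 1
  ext t
  simp [hu1]

theorem exists_eq_mul_of_norm_le {z : ℂ} {a : ℝ} (h : ‖z‖ ≤ a) :
    ∃ w : ℂ, ‖w‖ ≤ 1 ∧ z = a * w := by
  have ha : 0 ≤ a := (norm_nonneg z).trans h
  rcases ha.eq_or_lt with rfl | ha
  · exact ⟨0, by simp, by simpa using h⟩
  · refine ⟨z / a, ?_, ?_⟩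
    · rw [norm_div, Complex.norm_real, Real.norm_of_nonneg ha.le]
      exact div_le_one_of_le₀ h ha.le
    · have : (a : ℂ) ≠ 0 := by exact_mod_cast ha.ne'
      field_simp

/-- The Schur parameters of the first three trigonometric moments of a probability measure. -/
theorem exists_schur_parameters {α : Type*} [MeasurableSpace α] (μ : Measure α)
    [IsProbabilityMeasure μ] (u : α → ℂ) (hu : Measurable u) (hu1 : ∀ t, ‖u t‖ = 1) :
    ∃ g x y : ℂ, ‖g‖ ≤ 1 ∧ ‖x‖ ≤ 1 ∧ ‖y‖ ≤ 1 ∧ ∫ t, u t ∂μ = g ∧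
      ∫ t, u t ^ 2 ∂μ = g ^ 2 + (1 - g * conj g) * x ∧
      ∫ t, u t ^ 3 ∂μ = g ^ 3 + 2 * (1 - g * conj g) * g * x - (1 - g * conj g) * conj g * x ^ 2
        + (1 - g * conj g) * (1 - x * conj x) * y := by
  have huu : ∀ t, conj (u t) * u t = 1 := fun t => by
    rw [Complex.conj_mul', hu1]; simp
  have key := integral_trigonometric_polynomial μ u hu hu1
  set g := ∫ t, u t ∂μ with hg
  have hg1 : ‖g‖ ≤ 1 := by
    refine (norm_integral_le_integral_norm _).trans ?_
    simp [hu1]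
  -- Here `φ = u - g`, which is orthogonal to the constants.
  have q1 : ‖∫ t, u t ^ 2 ∂μ - g ^ 2‖ ≤ 1 - ‖g‖ ^ 2 := by
    have h := norm_integral_conj_mul_sq_le μ (fun _ => 1) (fun t => u t - g) (by simp)
    have e1 : ∫ t, conj (1 : ℂ) * (u t - g) ^ 2 ∂μ = ∫ t, u t ^ 2 ∂μ - g ^ 2 := by
      have := key (g ^ 2) (-2 * g) 1 0 0 0
      rw [show ∫ t, u t ^ 2 ∂μ - g ^ 2 = g ^ 2 + -2 * g * g + 1 * ∫ t, u t ^ 2 ∂μ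
        + 0 * ∫ t, u t ^ 3 ∂μ + 0 * conj g + 0 * conj (∫ t, u t ^ 2 ∂μ) by ring, ← this]
      congr 1
      ext t
      simp only [map_one]
      ring
    have e2 : ∫ t, (u t - g) * conj (u t - g) ∂μ = ((1 - ‖g‖ ^ 2 : ℝ) : ℂ) := by
      have := key (1 + g * conj g) (- conj g) 0 0 (-g) 0
      push_cast
      rw [← Complex.mul_conj', show 1 - g * conj g = 1 + g * conj g + - conj g * g
        + 0 * ∫ t, u t ^ 2 ∂μ
        + 0 * ∫ t, u t ^ 3 ∂μ + -g * conj g + 0 * conj (∫ t, u t ^ 2 ∂μ) by ring, ← this]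
      congr 1
      ext t
      simp only [map_sub]
      linear_combination huu t
    rw [e1, e2, Complex.ofReal_re] at h
    exact h
  obtain ⟨x, hx, hx2⟩ := exists_eq_mul_of_norm_le q1
  have hm2 : ∫ t, u t ^ 2 ∂μ = g ^ 2 + (1 - g * conj g) * x := by
    rw [Complex.mul_conj']
    push_cast at hx2
    linear_combination hx2
  have q2 : ‖∫ t, u t ^ 3 ∂μ - (g ^ 3 + 2 * (1 - g * conj g) * g * x
      - (1 - g * conj g) * conj g * x ^ 2)‖ ≤ (1 - ‖g‖ ^ 2) * (1 - ‖x‖ ^ 2) := by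
    -- This `φ` is the monic quadratic in `u` orthogonal to `1` and `u`; its squared norm is `(1 -
    -- ‖g‖²)(1 - ‖x‖²)`.
    have h := norm_integral_conj_mul_sq_le μ u
      (fun t => u t ^ 2 + (-g + x * conj g) * u t + -x) hu1
    have e1 : ∫ t, conj (u t) * (u t ^ 2 + (-g + x * conj g) * u t + -x) ^ 2 ∂μ
        = ∫ t, u t ^ 3 ∂μ - (g ^ 3 + 2 * (1 - g * conj g) * g * x
          - (1 - g * conj g) * conj g * x ^ 2) := by
      have := key (2 * (-g + x * conj g) * (-x)) ((-g + x * conj g) ^ 2 + 2 * (-x))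
        (2 * (-g + x * conj g)) 1 (x ^ 2) 0
      rw [hm2] at this
      trans
      · refine Eq.trans ?_ this
        congr 1
        ext t
        linear_combination (u t ^ 3 + 2 * (-g + x * conj g) * u t ^ 2
          + ((-g + x * conj g) ^ 2 + 2 * (-x)) * u t + 2 * (-g + x * conj g) * (-x)) * huu t
      · ring
    have e2 : ∫ t, (u t ^ 2 + (-g + x * conj g) * u t + -x)
          * conj (u t ^ 2 + (-g + x * conj g) * u t + -x) ∂μ
        = (((1 - ‖g‖ ^ 2) * (1 - ‖x‖ ^ 2) : ℝ) : ℂ) := by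
      have := key (1 + (-g + x * conj g) * (- conj g + conj x * g) + x * conj x)
        ((- conj g + conj x * g) + (-g + x * conj g) * (- conj x)) (- conj x) 0
        ((-g + x * conj g) + (- conj g + conj x * g) * (- x)) (- x)
      rw [hm2] at this
      push_cast
      rw [← Complex.mul_conj', ← Complex.mul_conj']
      trans
      · refine Eq.trans ?_ this
        congr 1
        ext t
        simp only [map_add, map_mul, map_neg, map_pow, Complex.conj_conj]
        linear_combination (u t * conj (u t) + 1 + (-g + x * conj g) * conj (u t)
          + (- conj g + conj x * g) * u t +
          (-g + x * conj g) * (- conj g + conj x * g)) * huu t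
      · simp only [map_add, map_mul, map_pow, map_sub, map_one, Complex.conj_conj]
        ring
    rw [e1, e2, Complex.ofReal_re] at h
    exact h
  obtain ⟨y, hy, hy2⟩ := exists_eq_mul_of_norm_le q2
  refine ⟨g, x, y, hg1, hx, hy, rfl, hm2, ?_⟩
  rw [Complex.mul_conj'] at hy2 ⊢
  rw [Complex.mul_conj']
  push_cast at hy2
  linear_combination hy2

/-! ### Bounds for the real majorant. -/

theorem majorant_at_zero {a : ℝ} (h0 : 0 ≤ a) (h1 : a ≤ 1) :
    13 / 108 * a ^ 6 + (1 - a ^ 2) * a ^ 4 / 18 + (1 - a ^ 2) * (a ^ 3 / 6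
      + 5 / 6 * (1 - a ^ 2) * a + (1 - a ^ 2) / 4) + 2 / 15 ≤ 331 / 540 := by
  -- The left side peaks near `a = 4/11`, so the hints are squares vanishing at or near that point.
  nlinarith [mul_nonneg h0 (sub_nonneg.2 h1), sq_nonneg (a ^ 2 - 1 / 8), sq_nonneg (a - 4 / 11),
    mul_nonneg h0 (sq_nonneg (a - 4 / 11)), mul_nonneg h0 (sq_nonneg (a ^ 2 - 4 / 11 * a)),
    sq_nonneg (a ^ 2 - 4 / 11 * a), sq_nonneg (a ^ 3 - 4 / 11 * a),
    mul_nonneg (sub_nonneg.2 h1) (sq_nonneg (a ^ 2 - 4 / 11 * a)),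
    mul_nonneg (sub_nonneg.2 h1) (sq_nonneg (a - 4 / 11))]

theorem majorant_at_one {T : ℝ} (h0 : 0 ≤ T) (h1 : T ≤ 1) :
    13 / 108 * T ^ 3 + (1 - T) * T ^ 2 / 9 + T * (5 / 9 * (1 - T) ^ 2 + T * (1 - T) / 6)
      + 8 / 27 * (1 - T) ^ 3 + 7 / 12 * T * (1 - T) ^ 2 + 2 / 15 * (2 - T) ≤ 331 / 540 := by
  nlinarith [mul_nonneg h0 (sub_nonneg.2 h1), mul_nonneg h0 (sq_nonneg (T - 1 / 18)),
    mul_nonneg (sub_nonneg.2 h1) (sq_nonneg (T - 1 / 18)), sq_nonneg (T - 1 / 18)]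

/-- Elementary bounds on the powers of `b` and on `q ^ 2` give a majorant affine in `b ^ 2`. It is
therefore the average, with weights `q` and `b ^ 2`, of its values at `b = 0` and `b = 1`, which are
the two preceding lemmas (the second with `T = a ^ 2`). -/
theorem majorant_le {a b s q : ℝ} (ha : 0 ≤ a) (ha1 : a ≤ 1) (hb : 0 ≤ b) (hb1 : b ≤ 1)
    (hs : s = 1 - a ^ 2) (hq : q = 1 - b ^ 2) :
    13 / 108 * a ^ 6 + 1 / 9 * s * a ^ 4 * b + 5 / 9 * s ^ 2 * a ^ 2 * b ^ 2
      + 1 / 6 * s * a ^ 4 * b ^ 2 + 8 / 27 * s ^ 3 * b ^ 3 + 1 / 3 * s ^ 2 * a ^ 2 * b ^ 3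
      + 1 / 4 * s ^ 2 * a ^ 2 * b ^ 4
      + s * q * (1 / 6 * a ^ 3 + 1 / 3 * s * a * b + 1 / 2 * s * a * b ^ 2)
      + 1 / 4 * s ^ 2 * q ^ 2 + (4 / 15 * s * b + 2 / 15 * a ^ 2) ≤ 331 / 540 := by
  have hs0 : 0 ≤ s := by nlinarith
  have hq0 : 0 ≤ q := by nlinarith
  have hq1 : q ≤ 1 := by nlinarith
  have b1 : b ≤ (1 + b ^ 2) / 2 := by nlinarith [sq_nonneg (b - 1)]
  have b2 : b ^ 2 ≤ 1 := by nlinarith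
  have b3 : b ^ 3 ≤ b ^ 2 := pow_le_pow_of_le_one hb hb1 (by norm_num)
  have b4 : b ^ 4 ≤ b ^ 2 := pow_le_pow_of_le_one hb hb1 (by norm_num)
  have q2 : q ^ 2 ≤ q := by nlinarith
  have p0 := mul_le_mul_of_nonneg_left (majorant_at_zero ha ha1) hq0
  have p1 := mul_le_mul_of_nonneg_left
    (majorant_at_one (sq_nonneg a) (by nlinarith : a ^ 2 ≤ 1)) (sq_nonneg b)
  calc _ ≤ 13 / 108 * a ^ 6 + 1 / 9 * s * a ^ 4 * ((1 + b ^ 2) / 2)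
      + 5 / 9 * s ^ 2 * a ^ 2 * b ^ 2
      + 1 / 6 * s * a ^ 4 * b ^ 2 + 8 / 27 * s ^ 3 * b ^ 2 + 1 / 3 * s ^ 2 * a ^ 2 * b ^ 2
      + 1 / 4 * s ^ 2 * a ^ 2 * b ^ 2
      + s * q * (1 / 6 * a ^ 3 + 1 / 3 * s * a * 1 + 1 / 2 * s * a * 1)
      + 1 / 4 * s ^ 2 * q + (4 / 15 * s * ((1 + b ^ 2) / 2) + 2 / 15 * a ^ 2) := by gcongr
    _ ≤ 331 / 540 := by
      subst hq hs
      linarith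

/-- A bound for the third Hankel determinant, written in the moments of a probability measure on
the circle with Schur parameters `g`, `x`, `y`. -/
theorem norm_hankel_moment_le (g x y w : ℂ) (hg : ‖g‖ ≤ 1) (hx : ‖x‖ ≤ 1) (hy : ‖y‖ ≤ 1)
    (hw : ‖w‖ ≤ 1) (m₂ m₃ : ℂ) (h₂ : m₂ = g ^ 2 + (1 - g * conj g) * x)
    (h₃ : m₃ = g ^ 3 + 2 * (1 - g * conj g) * g * x - (1 - g * conj g) * conj g * x ^ 2
        + (1 - g * conj g) * (1 - x * conj x) * y) :
    ‖2 / 3 * g * m₂ * m₃ - 8 / 27 * m₂ ^ 3 - 1 / 4 * m₃ ^ 2 + 4 / 15 * m₂ * w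
      - 2 / 5 * g ^ 2 * w‖ ≤ 993 / 1620 := by
  set s : ℝ := 1 - ‖g‖ ^ 2 with hs
  set q : ℝ := 1 - ‖x‖ ^ 2 with hq
  have hs0 : 0 ≤ s := by nlinarith [norm_nonneg g]
  have hq0 : 0 ≤ q := by nlinarith [norm_nonneg x]
  have es : 1 - g * conj g = (s : ℂ) := by rw [Complex.mul_conj']; push_cast [hs]; rfl
  have eq' : 1 - x * conj x = (q : ℂ) := by rw [Complex.mul_conj']; push_cast [hq]; rfl
  have es' : conj g * g = 1 - (s : ℂ) := by rw [← es]; ring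
  rw [es] at h₂
  rw [es, eq'] at h₃
  have expand : 2 / 3 * g * m₂ * m₃ - 8 / 27 * m₂ ^ 3 - 1 / 4 * m₃ ^ 2 + 4 / 15 * m₂ * w
      - 2 / 5 * g ^ 2 * w
      = 13 / 108 * g ^ 6 + 1 / 9 * s * g ^ 4 * x - 5 / 9 * s ^ 2 * g ^ 2 * x ^ 2
        - 1 / 6 * s * (g * conj g) * g ^ 2 * x ^ 2 - 8 / 27 * s ^ 3 * x ^ 3
        + 1 / 3 * s ^ 2 * (g * conj g) * x ^ 3 - 1 / 4 * s ^ 2 * conj g ^ 2 * x ^ 4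
        + s * q * (1 / 6 * g ^ 3 - 1 / 3 * s * g * x + 1 / 2 * s * conj g * x ^ 2) * y
        - 1 / 4 * s ^ 2 * q ^ 2 * y ^ 2 + (4 / 15 * s * x - 2 / 15 * g ^ 2) * w := by
    rw [h₃, h₂]; ring
  have hss : ‖(s : ℂ)‖ = s := by rw [Complex.norm_real, Real.norm_of_nonneg hs0]
  have hqq : ‖(q : ℂ)‖ = q := by rw [Complex.norm_real, Real.norm_of_nonneg hq0]
  have hgamma₂ : ‖1 / 6 * g ^ 3 - 1 / 3 * s * g * x + 1 / 2 * s * conj g * x ^ 2‖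
      ≤ 1 / 6 * ‖g‖ ^ 3 + 1 / 3 * s * ‖g‖ * ‖x‖ + 1 / 2 * s * ‖g‖ * ‖x‖ ^ 2 := by
    refine (norm_add_le _ _).trans ((add_le_add_left (norm_sub_le _ _) _).trans (le_of_eq ?_))
    simp only [norm_mul, norm_pow, norm_div, RCLike.norm_conj, hss]
    norm_num
  have hlast : ‖4 / 15 * s * x - 2 / 15 * g ^ 2‖ ≤ 4 / 15 * s * ‖x‖ + 2 / 15 * ‖g‖ ^ 2 := by
    refine (norm_sub_le _ _).trans (le_of_eq ?_)
    simp only [norm_mul, norm_pow, norm_div, hss]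
    norm_num
  have hA := mul_le_mul_of_nonneg_left (mul_le_mul hgamma₂ hy (norm_nonneg _) (by positivity))
    (mul_nonneg hs0 hq0)
  have hB := mul_le_mul hlast hw (norm_nonneg _) (by positivity)
  have hC : 1 / 4 * s ^ 2 * q ^ 2 * ‖y‖ ^ 2 ≤ 1 / 4 * s ^ 2 * q ^ 2 * 1 :=
    mul_le_mul_of_nonneg_left (pow_le_one₀ (norm_nonneg _) hy) (by positivity)
  rw [expand]
  have htri : ∀ t₁ t₂ t₃ t₄ t₅ t₆ t₇ t₈ t₉ t : ℂ,
      ‖t₁ + t₂ - t₃ - t₄ - t₅ + t₆ - t₇ + t₈ - t₉ + t‖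
        ≤ ‖t₁‖ + ‖t₂‖ + ‖t₃‖ + ‖t₄‖ + ‖t₅‖ + ‖t₆‖ + ‖t₇‖ + ‖t₈‖ + ‖t₉‖ + ‖t‖ := by
    intro t₁ t₂ t₃ t₄ t₅ t₆ t₇ t₈ t₉ t
    refine norm_add_le_of_le (norm_sub_le_of_le (norm_add_le_of_le (norm_sub_le_of_le
      (norm_add_le_of_le (norm_sub_le_of_le (norm_sub_le_of_le (norm_sub_le_of_le
      (norm_add_le _ _) ?_) ?_) ?_) ?_) ?_) ?_) ?_) ?_ <;> exact le_rfl
  refine (htri _ _ _ _ _ _ _ _ _ _).trans ?_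
  have hmaj := majorant_le (norm_nonneg g) hg (norm_nonneg x) hx hs hq
  simp only [norm_mul, norm_pow, norm_div, RCLike.norm_conj, hss, hqq, norm_one,
    RCLike.norm_ofNat] at hA hB ⊢
  linarith
end

/-! ### The measure attached to a function of positive real part. -/

section
open MeasureTheory ComplexConjugate Metric Real

theorem integral_circleMap_mul_exp_neg {p : ℂ → ℂ} {r : ℝ} (hr : 0 < r)
    (hp : DifferentiableOn ℂ p (closedBall 0 r)) (k : ℕ) :
    ∫ θ in 0..2 * π, p (circleMap 0 r θ) * Complex.exp (-(θ * Complex.I)) ^ k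
      = 2 * π * (iteratedDeriv k p 0 / k.factorial * r ^ k) := by
  have h := hp.circleIntegral_one_div_sub_center_pow_smul hr k
  have hr' : (r : ℂ) ≠ 0 := by exact_mod_cast hr.ne'
  have e : ∮ z in C(0, r), (1 / (z - 0) ^ (k + 1)) • p z = Complex.I / r ^ k *
      ∫ θ in 0..2 * π, p (circleMap 0 r θ) * Complex.exp (-(θ * Complex.I)) ^ k := by
    rw [circleIntegral, ← intervalIntegral.integral_const_mul]
    congr 1
    ext θ
    have := Complex.exp_ne_zero (θ * Complex.I)
    simp only [deriv_circleMap, circleMap_zero, smul_eq_mul, sub_zero, Complex.exp_neg,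
      inv_pow]
    field_simp
    ring
  rw [e, smul_eq_mul] at h
  have hI := Complex.I_ne_zero
  field_simp at h ⊢
  linear_combination h

/-- Cauchy's theorem for `z ^ k * p z`: an analytic function has no negative Fourier modes. -/
theorem integral_circleMap_mul_exp_eq_zero {p : ℂ → ℂ} {r : ℝ} (hr : 0 < r)
    (hp : DifferentiableOn ℂ p (closedBall 0 r)) (k : ℕ) :
    ∫ θ in 0..2 * π, p (circleMap 0 r θ) * Complex.exp (θ * Complex.I) ^ (k + 1) = 0 := by
  have hd : DifferentiableOn ℂ (fun z => z ^ k * p z) (closedBall 0 r) :=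
    (differentiableOn_id.pow k).mul hp
  have h : ∮ z in C(0, r), z ^ k * p z = 0 :=
    ((hd.mono closure_ball_subset_closedBall).diffContOnCl).circleIntegral_eq_zero hr.le
  have hr' : (r : ℂ) ≠ 0 := by exact_mod_cast hr.ne'
  have e : ∮ z in C(0, r), z ^ k * p z = Complex.I * r ^ (k + 1) *
      ∫ θ in 0..2 * π, p (circleMap 0 r θ) * Complex.exp (θ * Complex.I) ^ (k + 1) := by
    rw [circleIntegral, ← intervalIntegral.integral_const_mul]
    congr 1
    ext θ
    simp only [deriv_circleMap, circleMap_zero, smul_eq_mul]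
    ring
  rw [e] at h
  have hI := Complex.I_ne_zero
  simpa [hr'] using h

theorem integral_re_circleMap_mul_exp_neg {p : ℂ → ℂ} {r : ℝ} (hr : 0 < r)
    (hp : DifferentiableOn ℂ p (closedBall 0 r)) (k : ℕ) :
    ∫ θ in 0..2 * π, ((p (circleMap 0 r θ)).re : ℂ) * Complex.exp (-(θ * Complex.I)) ^ k
      = ((∫ θ in 0..2 * π, p (circleMap 0 r θ) * Complex.exp (-(θ * Complex.I)) ^ k)
        + conj (∫ θ in 0..2 * π, p (circleMap 0 r θ) * Complex.exp (θ * Complex.I) ^ k)) / 2 := by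
  have hc : Continuous fun θ => p (circleMap 0 r θ) :=
    hp.continuousOn.comp_continuous (continuous_circleMap 0 r)
      fun θ => circleMap_mem_closedBall 0 hr.le θ
  rw [← intervalIntegral.intervalIntegral_conj, ← intervalIntegral.integral_add, ← intervalIntegral.integral_div]
  · congr 1
    ext θ
    rw [Complex.re_eq_add_conj, map_mul, map_pow, ← Complex.exp_conj, map_mul, Complex.conj_ofReal,
      Complex.conj_I, mul_neg]
    ring
  · exact (hc.mul (by fun_prop)).intervalIntegrable _ _
  · exact (Complex.continuous_conj.comp (hc.mul (by fun_prop))).intervalIntegrable _ _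

/-- The normalized trigonometric moments of `Re p` on a circle are those of a probability measure
whose moments are half the Taylor coefficients of `p`. -/
theorem exists_probabilityMeasure_moments {p : ℂ → ℂ} {r : ℝ} (hr : 0 < r)
    (hp : DifferentiableOn ℂ p (closedBall 0 r)) (hp0 : p 0 = 1)
    (hre : ∀ z ∈ closedBall (0 : ℂ) r, 0 < (p z).re) :
    ∃ μ : Measure ℝ, IsProbabilityMeasure μ ∧ ∀ k : ℕ,
      ∫ θ : ℝ, Complex.exp (-(θ * Complex.I)) ^ (k + 1) ∂μ
        = iteratedDeriv (k + 1) p 0 / (k + 1).factorial * r ^ (k + 1) / 2 := by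
  have hc : Continuous fun θ => p (circleMap 0 r θ) :=
    hp.continuousOn.comp_continuous (continuous_circleMap 0 r)
      fun θ => circleMap_mem_closedBall 0 hr.le θ
  set ρ : ℝ → ℝ := fun θ => (p (circleMap 0 r θ)).re / (2 * π) with hρ
  have hρc : Continuous ρ := (Complex.continuous_re.comp hc).div_const _
  have hρ0 : ∀ θ, 0 ≤ ρ θ := fun θ =>
    div_nonneg (hre _ (circleMap_mem_closedBall 0 hr.le θ)).le (by positivity)
  have hπ : (π : ℂ) ≠ 0 := by exact_mod_cast pi_ne_zero
  have hint : ∀ k : ℕ, ∫ θ in 0..2 * π, (ρ θ : ℂ) * Complex.exp (-(θ * Complex.I)) ^ k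
      = (iteratedDeriv k p 0 / k.factorial * r ^ k + conj (∫ θ in 0..2 * π,
        p (circleMap 0 r θ) * Complex.exp (θ * Complex.I) ^ k) / (2 * π)) / 2 := by
    intro k
    have := integral_re_circleMap_mul_exp_neg hr hp k
    rw [integral_circleMap_mul_exp_neg hr hp k] at this
    trans (∫ θ in 0..2 * π, ((p (circleMap 0 r θ)).re : ℂ)
      * Complex.exp (-(θ * Complex.I)) ^ k) / (2 * π)
    · rw [← intervalIntegral.integral_div]
      congr 1
      ext θ
      simp only [hρ]
      push_cast
      ring
    · rw [this]
      generalize ∫ θ in 0..2 * π, p (circleMap 0 r θ) * Complex.exp (θ * Complex.I) ^ k = J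
      field_simp
  -- For `k = 0` both `p` and its conjugate contribute `p 0 = 1`, so no factor `1/2` survives; for
  -- `k ≥ 1` the conjugate term vanishes.
  have h0 : ∫ θ in 0..2 * π, ρ θ = 1 := by
    have h1 := hint 0
    have h2 := integral_circleMap_mul_exp_neg hr hp 0
    simp only [pow_zero, mul_one, iteratedDeriv_zero, hp0, Nat.factorial_zero, Nat.cast_one,
      div_one] at h1 h2
    rw [h2, intervalIntegral.integral_ofReal] at h1
    have h3 : ((∫ θ in 0..2 * π, ρ θ : ℝ) : ℂ) = 1 := by
      rw [h1]
      simp only [map_mul, Complex.conj_ofReal, map_ofNat]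
      field_simp
      norm_num
    exact_mod_cast h3
  have h2π : (0 : ℝ) ≤ 2 * π := by positivity
  rw [intervalIntegral.integral_of_le h2π] at h0
  refine ⟨(volume.restrict (Set.Ioc 0 (2 * π))).withDensity fun θ => ENNReal.ofReal (ρ θ),
    ⟨?_⟩, fun k => ?_⟩
  · rw [withDensity_apply _ MeasurableSet.univ, Measure.restrict_univ,
      ← ofReal_integral_eq_lintegral_ofReal _ (Filter.Eventually.of_forall hρ0), h0,
      ENNReal.ofReal_one]
    exact (hρc.integrableOn_Icc (a := 0) (b := 2 * π)).mono_set Set.Ioc_subset_Icc_self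
  · rw [integral_withDensity_eq_integral_toReal_smul (by fun_prop)
      (Filter.Eventually.of_forall fun _ => ENNReal.ofReal_lt_top)]
    have h1 := hint (k + 1)
    rw [integral_circleMap_mul_exp_eq_zero hr hp k, intervalIntegral.integral_of_le h2π] at h1
    simp only [map_zero, zero_div, add_zero] at h1
    rw [← h1]
    congr 1
    ext θ
    rw [ENNReal.toReal_ofReal (hρ0 θ), Complex.real_smul]

/-! ### The Hankel determinant in terms of the coefficients of `f'`. -/

theorem taylorCoeff_succ (f : ℂ → ℂ) (k : ℕ) :
    taylorCoeff f (k + 1) = iteratedDeriv k (deriv f) 0 / k.factorial / (k + 1) := by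
  rw [taylorCoeff, iteratedDeriv_succ', Nat.factorial_succ]
  push_cast
  rw [div_div, mul_comm]

theorem hankelDet_three_one (f : ℂ → ℂ) (c : ℕ → ℂ)
    (hc : ∀ k, taylorCoeff f (k + 1) = c k / (k + 1)) (hc0 : c 0 = 1) :
    hankelDet f 3 1 = c 1 * c 2 * c 3 / 12 - c 2 ^ 3 / 27 - c 3 ^ 2 / 16 + c 2 * c 4 / 15
      - c 1 ^ 2 * c 4 / 20 := by
  have h1 := hc 0
  have h2 := hc 1
  have h3 := hc 2
  have h4 := hc 3
  have h5 := hc 4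
  norm_num [hc0] at h1 h2 h3 h4 h5
  rw [hankelDet, Matrix.det_fin_three]
  simp only [Matrix.of_apply, Fin.val_zero, Fin.val_one, Fin.val_two, add_zero, Nat.reduceAdd,
    h1, h2, h3, h4, h5]
  ring

theorem pow_mul_norm_hankelDet_le {f : ℂ → ℂ} (hf : BoundedTurning f) {r : ℝ} (hr : 0 < r)
    (hr1 : r < 1) : r ^ 6 * ‖hankelDet f 3 1‖ ≤ 993 / 1620 := by
  have hsub : closedBall (0 : ℂ) r ⊆ unitDiskE := fun z hz =>
    lt_of_le_of_lt (by simpa using hz) hr1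
  obtain ⟨μ, hμ, hm⟩ := exists_probabilityMeasure_moments (p := deriv f) hr
    (hf.analytic.deriv.differentiableOn.mono hsub) hf.deriv_zero
    fun z hz => hf.re_deriv_pos z (hsub hz)
  have hu1 : ∀ θ : ℝ, ‖Complex.exp (-(θ * Complex.I))‖ = 1 := fun θ => by
    simp [Complex.norm_exp]
  obtain ⟨g, x, y, hg, hx, hy, e1, e2, e3⟩ := exists_schur_parameters μ
    (fun θ : ℝ => Complex.exp (-(θ * Complex.I))) (by fun_prop) hu1
  have hw : ‖∫ θ : ℝ, Complex.exp (-(θ * Complex.I)) ^ 4 ∂μ‖ ≤ 1 :=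
    (norm_integral_le_integral_norm _).trans (by simp [hu1])
  have hb := norm_hankel_moment_le g x y _ hg hx hy hw _ _ e2 e3
  rw [← e1] at hb
  rw [← Real.norm_of_nonneg (pow_pos hr 6).le, ← Complex.norm_real, ← norm_mul]
  have m1 := hm 0
  rw [zero_add] at m1
  simp only [pow_one] at m1
  rw [m1, hm 1, hm 2, hm 3] at hb
  rw [hankelDet_three_one f _ (taylorCoeff_succ f) (by simpa using hf.deriv_zero)]
  -- Every monomial has weight 6, so the factors `r ^ k` in the moments combine to `r ^ 6`.
  convert hb using 2
  push_cast
  ring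
end

theorem corollary3p2 (f : ℂ → ℂ) (hf : BoundedTurning f) :
    ‖hankelDet f 3 1‖ ≤ 993 / 1620 := by
  have ht : Filter.Tendsto (fun r : ℝ => r ^ 6 * ‖hankelDet f 3 1‖) (nhdsWithin 1 (Set.Iio 1))
      (nhds (1 ^ 6 * ‖hankelDet f 3 1‖)) :=
    ((continuous_id.pow 6).mul continuous_const).continuousAt.tendsto.mono_left
      nhdsWithin_le_nhds
  rw [one_pow, one_mul] at ht
  refine le_of_tendsto ht ?_
  filter_upwards [Ioo_mem_nhdsLT (zero_lt_one' ℝ)] with r hr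
  exact pow_mul_norm_hankelDet_le hf hr.1 hr.2
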